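/- For integers $n$ define $s_\gamma(n)=\lfloor (n+1)\gamma\rfloor-\lfloor n\gamma\rfloor$, where $\gamma=(3-\sqrt5)/2$, and let $g_i=s_\gamma(i+1)$ for all $i\in\mathbb{Z}$. Let $F_0=0$, $F_1=1$, $F_n=F_{n-1}+F_{n-2}$ be the Fibonacci numbers. The canonical negaFibonacci representation of an integer $n$ is the unique binary word $e_te_{t-1}\cdots e_1$ without leading zeros such that $e_ie_{i+1}\neq 1$ for $1\le i<t$ and $n=\sum_{1\le i\le t}e_i(-1)^{i+1}F_i$ (the empty word for $n=0$). For $i\in\mathbb{Z}$ let $h_i$ be the least significant digit $e_1$ of the canonical negaFibonacci representation of $i$, with $h_0=0$. Then for all integers $i$: (a) $g_i=g_{-3-i}$ for $i\notin\{-2,-1\}$; (b) $h_i=h_{1-i}$ for $i\notin\{0,1\}$; (c) $g_{i-1}=h_{i+1}$ for $i\notin\{-1,0\}$. -/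

import Mathlib

namespace FibWords

/-- The real number `γ = (3 - √5) / 2`. -/
noncomputable def γ : ℝ := (3 - Real.sqrt 5) / 2

/-- `s_θ(n) = ⌊(n+1)θ⌋ - ⌊nθ⌋`, for every integer `n`. -/
noncomputable def sturmian (θ : ℝ) (n : ℤ) : ℤ := ⌊((n : ℝ) + 1) * θ⌋ - ⌊(n : ℝ) * θ⌋

/-- The bi-infinite word `g`, with `g_i = s_γ(i+1)` for all integers `i`. -/
noncomputable def g (i : ℤ) : ℤ := sturmian γ (i + 1)

/-- The integer `∑_{1 ≤ i ≤ t} e_i (-1)^(i+1) F_i` denoted by the word `e_t e_{t-1} ⋯ e_1`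
(most significant digit first); the head of the word `d :: w` has index `i = w.length + 1`. -/
def negaFibValue : List ℕ → ℤ
  | [] => 0
  | d :: w => (d : ℤ) * ((-1) ^ ((w.length + 1) + 1) * (Nat.fib (w.length + 1) : ℤ)) + negaFibValue w

/-- A binary word with no two adjacent digits `1` (leading zeros are allowed). -/
def IsAdmissible (w : List ℕ) : Prop :=
  (∀ d ∈ w, d = 0 ∨ d = 1) ∧ w.IsChain (fun a b => a * b ≠ 1)

/-- `w` is a canonical negaFibonacci representation of `n`: a binary word with no two adjacent
digits `1`, without leading zeros, that denotes `n`. -/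
def IsNegaFibRep (n : ℤ) (w : List ℕ) : Prop :=
  IsAdmissible w ∧ w.head? ≠ some 0 ∧ negaFibValue w = n

/-- The interval of integers denoted by the admissible words of length `t`
(auxiliary, used only to show that representations exist and are unique). -/
def InRange (t : ℕ) (x : ℤ) : Prop :=
  (Even t → 1 - (Nat.fib (t + 1) : ℤ) ≤ x ∧ x ≤ Nat.fib t) ∧
  (¬ Even t → 1 - (Nat.fib t : ℤ) ≤ x ∧ x ≤ Nat.fib (t + 1))

theorem inRange_succ {t : ℕ} {x : ℤ} (h : InRange t x) : InRange (t + 1) x := by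
  have h1 : (Nat.fib (t + 2) : ℤ) = Nat.fib t + Nat.fib (t + 1) := by
    exact_mod_cast Nat.fib_add_two
  have h2 : (0 : ℤ) ≤ Nat.fib (t + 1) := by positivity
  have h3 : (0 : ℤ) ≤ Nat.fib t := by positivity
  unfold InRange at *
  rw [Nat.even_add_one]
  by_cases ht : Even t
  · simp only [ht, forall_const, not_true, not_false_iff, false_imp_iff, true_and, and_true] at *
    exact ⟨h.1, by rw [h1]; linarith [h.2]⟩
  · simp only [ht, forall_const, not_true, not_false_iff, false_imp_iff, true_and, and_true] at *
    exact ⟨by rw [h1]; linarith [h.1], h.2⟩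

theorem inRange_mono {s t : ℕ} (hst : s ≤ t) {x : ℤ} (h : InRange s x) : InRange t x := by
  induction t, hst using Nat.le_induction with
  | base => exact h
  | succ k _ ih => exact inRange_succ ih

theorem inRange_step (t : ℕ) (x : ℤ) :
    (InRange (t + 2) ((-1) ^ ((t + 1 + 1) + 1) * (Nat.fib (t + 1 + 1) : ℤ) + x) ∧
      ¬ InRange (t + 1) ((-1) ^ ((t + 1 + 1) + 1) * (Nat.fib (t + 1 + 1) : ℤ) + x)) ↔
    InRange t x := by
  have h1 : (Nat.fib (t + 2) : ℤ) = Nat.fib t + Nat.fib (t + 1) := by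
    exact_mod_cast Nat.fib_add_two
  have h4 : (Nat.fib (t + 3) : ℤ) = Nat.fib (t + 1) + Nat.fib (t + 2) := by
    exact_mod_cast Nat.fib_add_two
  have h2 : (0 : ℤ) < Nat.fib (t + 1) := by exact_mod_cast Nat.fib_pos.2 (Nat.succ_pos t)
  have h3 : (0 : ℤ) ≤ Nat.fib t := by positivity
  have e1 : Even (t + 1) ↔ ¬ Even t := Nat.even_add_one
  have e2 : Even (t + 2) ↔ Even t := by rw [Nat.even_add_one, e1, not_not]
  unfold InRange
  rw [e1, e2]
  by_cases ht : Even t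
  · have hp : (-1 : ℤ) ^ ((t + 1 + 1) + 1) = -1 := by
      apply Odd.neg_one_pow
      rw [← Nat.not_even_iff_odd, Nat.even_add_one, not_not]
      exact e2.2 ht
    rw [hp]
    simp only [ht, forall_const, not_true, not_false_iff, false_imp_iff, true_and, and_true]
    rw [show t + 2 + 1 = t + 3 from rfl, show t + 1 + 1 = t + 2 from rfl, h4, h1]
    omega
  · have hp : (-1 : ℤ) ^ ((t + 1 + 1) + 1) = 1 := by
      apply Even.neg_one_pow
      rw [Nat.even_add_one]
      exact fun h => ht (e2.1 h)
    rw [hp]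
    simp only [ht, forall_const, not_true, not_false_iff, false_imp_iff, true_and, and_true]
    rw [show t + 2 + 1 = t + 3 from rfl, show t + 1 + 1 = t + 2 from rfl, h4, h1]
    omega

theorem IsAdmissible.tail {d : ℕ} {w : List ℕ} (h : IsAdmissible (d :: w)) : IsAdmissible w :=
  ⟨fun e he => h.1 e (List.mem_cons_of_mem _ he), h.2.tail⟩

theorem IsAdmissible.zero_cons {w : List ℕ} (h : IsAdmissible w) : IsAdmissible (0 :: w) := by
  refine ⟨?_, ?_⟩
  · intro d hd
    rcases List.mem_cons.1 hd with rfl | hd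
    · exact Or.inl rfl
    · exact h.1 d hd
  · cases w with
    | nil => exact List.IsChain.singleton _
    | cons a w => exact List.IsChain.cons_cons (by simp) h.2

theorem IsAdmissible.one_zero_cons {w : List ℕ} (h : IsAdmissible w) :
    IsAdmissible (1 :: 0 :: w) := by
  refine ⟨?_, List.IsChain.cons_cons (by simp) h.zero_cons.2⟩
  intro d hd
  rcases List.mem_cons.1 hd with rfl | hd
  · exact Or.inr rfl
  · exact h.zero_cons.1 d hd

theorem negaFibValue_zero_cons (w : List ℕ) : negaFibValue (0 :: w) = negaFibValue w := by
  simp [negaFibValue]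

theorem inRange_zero (x : ℤ) : InRange 0 x ↔ x = 0 := by
  simp [InRange]; omega

theorem inRange_one (x : ℤ) : InRange 1 x ↔ x = 0 ∨ x = 1 := by
  simp [InRange]; omega

theorem inRange_value (t : ℕ) : ∀ w : List ℕ, w.length = t → IsAdmissible w →
    InRange t (negaFibValue w) ∧ ∀ u, w = 1 :: u → ¬ InRange u.length (negaFibValue w) := by
  induction t using Nat.strong_induction_on with
  | _ t ih =>
    intro w hw hadm
    match w, hw, hadm with
    | [], hw, _ =>
      subst hw
      simp [negaFibValue, inRange_zero]
    | d :: u, hw, hadm =>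
      rcases hadm.1 d (by simp) with rfl | rfl
      · have h := ih u.length (by simp at hw; omega) u rfl hadm.tail
        rw [negaFibValue_zero_cons]
        subst hw
        exact ⟨inRange_succ h.1, by simp⟩
      · match u, hw, hadm with
        | [], hw, _ =>
          subst hw
          simp [negaFibValue, inRange_zero, inRange_one]
        | e :: v, hw, hadm =>
          have he : e = 0 := by
            rcases hadm.1 e (by simp) with h | h
            · exact h
            · subst h
              exact absurd rfl (List.isChain_cons_cons.1 hadm.2).1
          subst he
          have h := ih v.length (by simp at hw; omega) v rfl hadm.tail.tail
          have hs := (inRange_step v.length (negaFibValue v)).2 h.1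
          have hv : negaFibValue (1 :: 0 :: v) =
              (-1) ^ ((v.length + 1 + 1) + 1) * (Nat.fib (v.length + 1 + 1) : ℤ)
                + negaFibValue v := by
            simp [negaFibValue]
          rw [hv]
          subst hw
          refine ⟨hs.1, ?_⟩
          intro u hu
          obtain rfl : 0 :: v = u := by simpa using hu
          exact hs.2

theorem exists_admissible (t : ℕ) : ∀ n : ℤ, InRange t n →
    ∃ w : List ℕ, w.length = t ∧ IsAdmissible w ∧ negaFibValue w = n := by
  have hnil : IsAdmissible [] := ⟨by simp, List.IsChain.nil⟩
  induction t using Nat.twoStepInduction with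
  | zero =>
    intro n hn
    exact ⟨[], rfl, hnil, ((inRange_zero n).1 hn).symm⟩
  | one =>
    intro n hn
    rcases (inRange_one n).1 hn with rfl | rfl
    · exact ⟨[0], rfl, hnil.zero_cons, by simp [negaFibValue]⟩
    · exact ⟨[1], rfl, ⟨by simp, List.IsChain.singleton _⟩, by simp [negaFibValue]⟩
  | more t ih0 ih1 =>
    intro n hn
    by_cases h : InRange (t + 1) n
    · obtain ⟨w, hl, hw, hv⟩ := ih1 n h
      exact ⟨0 :: w, by simp [hl], hw.zero_cons, by rw [negaFibValue_zero_cons, hv]⟩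
    · have hs := inRange_step t (n - (-1) ^ ((t + 1 + 1) + 1) * (Nat.fib (t + 1 + 1) : ℤ))
      rw [add_sub_cancel] at hs
      obtain ⟨w, hl, hw, hv⟩ := ih0 _ (hs.1 ⟨hn, h⟩)
      refine ⟨1 :: 0 :: w, by simp [hl], hw.one_zero_cons, ?_⟩
      simp [negaFibValue, hl, hv]

theorem exists_canonical (w : List ℕ) (hw : IsAdmissible w) :
    ∃ u, IsNegaFibRep (negaFibValue w) u := by
  induction w with
  | nil => exact ⟨[], hw, by simp, rfl⟩
  | cons d w ih =>
    rcases hw.1 d (by simp) with rfl | rfl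
    · rw [negaFibValue_zero_cons]
      exact ih hw.tail
    · exact ⟨1 :: w, hw, by simp, rfl⟩

theorem eq_of_length_eq (w : List ℕ) : ∀ u : List ℕ, w.length = u.length → IsAdmissible w →
    IsAdmissible u → negaFibValue w = negaFibValue u → w = u := by
  induction w with
  | nil =>
    intro u hl _ _ _
    exact (List.length_eq_zero_iff.1 hl.symm).symm
  | cons d w ih =>
    intro u hl hw hu hv
    cases u with
    | nil => simp at hl
    | cons e u =>
      have hl' : w.length = u.length := by simpa using hl
      have key : ∀ a b : List ℕ, a.length = b.length → IsAdmissible (0 :: a) →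
          IsAdmissible (1 :: b) → negaFibValue (0 :: a) ≠ negaFibValue (1 :: b) := by
        intro a b hab ha hb he
        have h1 := (inRange_value _ a rfl ha.tail).1
        have h2 := (inRange_value _ (1 :: b) rfl hb).2 b rfl
        rw [← he, negaFibValue_zero_cons, ← hab] at h2
        exact h2 h1
      rcases hw.1 d (by simp) with rfl | rfl <;> rcases hu.1 e (by simp) with rfl | rfl
      · rw [negaFibValue_zero_cons, negaFibValue_zero_cons] at hv
        rw [ih u hl' hw.tail hu.tail hv]
      · exact absurd hv (key w u hl' hw hu)
      · exact absurd hv.symm (key u w hl'.symm hu hw)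
      · have hv' : negaFibValue w = negaFibValue u := by
          simpa [negaFibValue, hl'] using hv
        rw [ih u hl' hw.tail hu.tail hv']

theorem IsNegaFibRep.length_le {n : ℤ} {w u : List ℕ} (hw : IsNegaFibRep n w)
    (hu : IsNegaFibRep n u) : u.length ≤ w.length := by
  by_contra! hlt
  obtain ⟨hwa, -, hwv⟩ := hw
  obtain ⟨hua, huh, huv⟩ := hu
  cases u with
  | nil => simp at hlt
  | cons d u =>
    rcases hua.1 d (by simp) with rfl | rfl
    · simp at huh
    · have h1 := (inRange_value _ w rfl hwa).1
      have h2 := (inRange_value _ (1 :: u) rfl hua).2 u rfl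
      rw [huv, ← hwv] at h2
      exact h2 (inRange_mono (by simp at hlt; omega) h1)

theorem exists_inRange (n : ℤ) : ∃ t, InRange t n := by
  have hf : ∀ k : ℕ, (k : ℤ) ≤ Nat.fib (k + 1) := by
    intro k
    induction k using Nat.twoStepInduction with
    | zero => simp
    | one => simp
    | more k ih0 ih1 =>
      have h1 : (Nat.fib (k + 2 + 1) : ℤ) = Nat.fib (k + 1) + Nat.fib (k + 1 + 1) := by
        exact_mod_cast Nat.fib_add_two
      have h2 : (0 : ℤ) < Nat.fib (k + 1) := by exact_mod_cast Nat.fib_pos.2 (Nat.succ_pos k)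
      push_cast at *
      omega
  refine ⟨2 * (n.natAbs + 1), ?_⟩
  have he : Even (2 * (n.natAbs + 1)) := even_two_mul _
  have h1 := hf (2 * (n.natAbs + 1))
  have h2 := hf (2 * n.natAbs + 1)
  have h3 := neg_abs_le n
  have h4 := le_abs_self n
  refine ⟨fun _ => ⟨?_, ?_⟩, fun h => absurd he h⟩
  · push_cast at h1; omega
  · rw [show 2 * n.natAbs + 1 + 1 = 2 * (n.natAbs + 1) by ring] at h2
    push_cast at h2
    omega

/-- Every integer has exactly one canonical negaFibonacci representation. -/
theorem existsUnique_negaFibRep (n : ℤ) : ∃! w, IsNegaFibRep n w := by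
  obtain ⟨t, ht⟩ := exists_inRange n
  obtain ⟨w, -, hw, hv⟩ := exists_admissible t n ht
  obtain ⟨u, hu⟩ := exists_canonical w hw
  rw [hv] at hu
  refine ⟨u, hu, fun v hv' => ?_⟩
  exact eq_of_length_eq v u (le_antisymm (hu.length_le hv') (hv'.length_le hu)) hv'.1 hu.1
    (hv'.2.2.trans hu.2.2.symm)

/-- The canonical negaFibonacci representation of `n`, most significant digit first. -/
noncomputable def negaFibRep (n : ℤ) : List ℕ := (existsUnique_negaFibRep n).choose

/-- The bi-infinite word `h`: `h_i` is the least significant (last) digit of the canonical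
negaFibonacci representation of `i`; the representation of `0` is the empty word, whose digits
are all read as `0`. -/
noncomputable def h (i : ℤ) : ℕ := (negaFibRep i).getLastD 0

end FibWords

namespace FibWords

/-! Put `a = 1 - γ`, so `a² = γ = 1 - a`. Modulo 1, `(-1)^(k+1) F_k γ` is `-a^k`, so an admissible
word for `n` with digit sum `S = ∑ e_i a^i` gives `nγ ≡ -S`. Since no two digits 1 are adjacent, `0
≤ S < 1`, and the last digit is 1 exactly when `S ≥ a` (`conjValue_bounds`). As `a + γ = 1`, this
says that an integer separates `(n-1)γ` from `nγ`, apart from the boundary values `S = 0` (`n = 0`)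
and `S = a` (`n = 1`). Thus `h` is a floor difference (`h_eq_floor_sub_floor`), which is (c); (a)
and (b) both follow from the symmetry `n ↦ 1 - n` of that difference. -/

theorem one_sub_γ_sq : (1 - γ) ^ 2 = γ := by
  have h5 : Real.sqrt 5 ^ 2 = 5 := Real.sq_sqrt (by norm_num)
  unfold γ
  nlinarith

theorem γ_pos : 0 < γ := by
  have h5 : Real.sqrt 5 < 3 := by
    rw [Real.sqrt_lt' (by norm_num)]; norm_num
  unfold γ
  linarith

theorem γ_lt_half : γ < 1 / 2 := by
  have h5 : 2 < Real.sqrt 5 := by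
    rw [Real.lt_sqrt (by norm_num)]; norm_num
  unfold γ
  linarith

theorem irrational_γ : Irrational γ := by
  have h5 : Irrational (Real.sqrt 5) := by
    simpa using Nat.Prime.irrational_sqrt (p := 5) (by norm_num)
  rintro ⟨q, hq⟩
  refine h5 ⟨3 - 2 * q, ?_⟩
  push_cast
  rw [hq]
  unfold γ
  ring

theorem eq_zero_of_mul_γ_eq {n m : ℤ} (hnm : (n : ℝ) * γ = m) : n = 0 := by
  by_contra hn
  exact (irrational_γ.intCast_mul hn).ne_int m hnm

/-! ### Representations modulo 1 -/

/-- The sum `∑ e_i (1 - γ)^i` over the digits of the word `e_t ⋯ e_1`. -/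
noncomputable def conjValue : List ℕ → ℝ
  | [] => 0
  | d :: w => (d : ℝ) * (1 - γ) ^ (w.length + 1) + conjValue w

/-- Both `(-1)^(k+1) F_k` and `(1 - γ)^k` satisfy `x_{k+2} = x_k - x_{k+1}`. -/
theorem exists_fib_mul_γ (k : ℕ) :
    ∃ m : ℤ, (-1 : ℝ) ^ (k + 1) * (Nat.fib k : ℝ) * γ = m - (1 - γ) ^ k := by
  induction k using Nat.twoStepInduction with
  | zero => exact ⟨1, by simp⟩
  | one => exact ⟨1, by simp⟩
  | more k ih0 ih1 =>
    obtain ⟨m, hm⟩ := ih0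
    obtain ⟨l, hl⟩ := ih1
    refine ⟨m - l, ?_⟩
    rw [Nat.fib_add_two]
    push_cast
    have hpow : (1 - γ) ^ (k + 2) = (1 - γ) ^ k - (1 - γ) ^ (k + 1) := by
      rw [pow_add, one_sub_γ_sq]; ring
    rw [hpow]
    linear_combination hm - hl

theorem exists_negaFibValue_mul_γ (w : List ℕ) :
    ∃ m : ℤ, (negaFibValue w : ℝ) * γ = m - conjValue w := by
  induction w with
  | nil => exact ⟨0, by simp [negaFibValue, conjValue]⟩
  | cons d w ih =>
    obtain ⟨m, hm⟩ := ih
    obtain ⟨l, hl⟩ := exists_fib_mul_γ (w.length + 1)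
    refine ⟨d * l + m, ?_⟩
    simp only [negaFibValue, conjValue]
    push_cast
    linear_combination hm + (d : ℝ) * hl

theorem conjValue_nonneg (w : List ℕ) : 0 ≤ conjValue w := by
  induction w with
  | nil => exact le_rfl
  | cons d w ih =>
    have ha : 0 ≤ 1 - γ := by linarith [γ_lt_half]
    simp only [conjValue]
    positivity

/-- The bounds are the geometric sums `a + a³ + ⋯ = 1` and `a² + a⁴ + ⋯ = a`, where `a = 1 - γ`. The
slack `a^(t+1)` keeps the upper bounds strict for finite words and lets the induction close. -/
theorem conjValue_bounds (t : ℕ) : ∀ w : List ℕ, w.length = t → IsAdmissible w →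
    conjValue w ≤ 1 - (1 - γ) ^ (t + 1) ∧
    ((w.getLastD 0 = 0 ∧ conjValue w ≤ (1 - γ) - (1 - γ) ^ (t + 1)) ∨
      (w.getLastD 0 = 1 ∧ 1 - γ ≤ conjValue w)) := by
  have hγ := γ_pos
  have hγ' := γ_lt_half
  have hsq := one_sub_γ_sq
  have hpow : ∀ k, (1 - γ) ^ (k + 1) ≤ (1 - γ) ^ k := fun k =>
    pow_le_pow_of_le_one (by linarith) (by linarith) (Nat.le_succ k)
  induction t using Nat.strong_induction_on with
  | _ t ih =>
    intro w hw hadm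
    match w, hw, hadm with
    | [], hw, _ =>
      subst hw
      simp only [conjValue, List.getLastD_nil]
      norm_num
      linarith
    | d :: u, hw, hadm =>
      rcases hadm.1 d (by simp) with rfl | rfl
      · obtain ⟨h1, h2⟩ := ih u.length (by simp at hw; omega) u rfl hadm.tail
        have hp := hpow (u.length + 1)
        subst hw
        simp only [conjValue, List.getLastD_cons, List.length_cons, Nat.cast_zero, zero_mul,
          zero_add]
        refine ⟨by linarith, h2.imp (fun h => ⟨h.1, by linarith [h.2]⟩) id⟩
      · match u, hw, hadm with
        | [], hw, _ =>
          subst hw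
          simp only [conjValue, List.length_cons, List.length_nil, Nat.cast_one, zero_add,
            List.getLastD_cons, List.getLastD_nil]
          norm_num
          linarith
        | e :: v, hw, hadm =>
          have he : e = 0 := by
            rcases hadm.1 e (by simp) with h | h
            · exact h
            · subst h
              exact absurd rfl (List.isChain_cons_cons.1 hadm.2).1
          subst he
          obtain ⟨h1, h2⟩ := ih v.length (by simp at hw; omega) v rfl hadm.tail.tail
          subst hw
          -- Prepending `10` adds exactly the amount by which the slack shrinks.
          have hp : (1 - γ) ^ (v.length + 1 + 1 + 1) =
              (1 - γ) ^ (v.length + 1) - (1 - γ) ^ (v.length + 1 + 1) := by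
            rw [pow_succ, pow_succ, mul_assoc, ← sq, hsq]
            ring
          have hn : 0 ≤ (1 - γ) ^ (v.length + 1 + 1) := pow_nonneg (by linarith) _
          simp only [conjValue, List.getLastD_cons, List.length_cons, Nat.cast_zero, zero_mul,
            zero_add, Nat.cast_one, one_mul]
          refine ⟨by linarith, h2.imp (fun h => ⟨h.1, by linarith [h.2]⟩)
            (fun h => ⟨h.1, by linarith [h.2]⟩)⟩

theorem h_eq_floor_sub_floor {n : ℤ} (h0 : n ≠ 0) (h1 : n ≠ 1) :
    (h n : ℤ) = ⌊(n : ℝ) * γ⌋ - ⌊((n : ℝ) - 1) * γ⌋ := by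
  obtain ⟨hadm, -, hval⟩ : IsNegaFibRep n (negaFibRep n) :=
    (existsUnique_negaFibRep n).choose_spec.1
  obtain ⟨m, hm⟩ := exists_negaFibValue_mul_γ (negaFibRep n)
  obtain ⟨hle, hlast⟩ := conjValue_bounds _ (negaFibRep n) rfl hadm
  have hnn := conjValue_nonneg (negaFibRep n)
  have hγ := γ_pos
  have hγ' := γ_lt_half
  have hp : 0 < (1 - γ) ^ ((negaFibRep n).length + 1) := pow_pos (by linarith) _
  rw [hval] at hm
  set S := conjValue (negaFibRep n)
  -- `S = 0` would make `nγ` an integer, against irrationality.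
  have hS : 0 < S := by
    refine lt_of_le_of_ne hnn fun hz => h0 (eq_zero_of_mul_γ_eq (m := m) ?_)
    rw [hm, ← hz, sub_zero]
  have hfloor : ⌊(n : ℝ) * γ⌋ = m - 1 := by
    rw [Int.floor_eq_iff]
    push_cast
    constructor <;> linarith
  rw [hfloor]
  unfold h
  rcases hlast with ⟨hd, hS'⟩ | ⟨hd, hS'⟩
  · have : ⌊((n : ℝ) - 1) * γ⌋ = m - 1 := by
      rw [Int.floor_eq_iff]
      push_cast
      constructor <;> linarith
    rw [hd, this]
    simp
  -- At `S = 1 - γ`, `(n-1)γ` would be an integer; this is where `n ≠ 1` enters.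
  · have hne : 1 - γ < S := by
      refine lt_of_le_of_ne hS' fun hz => h1 ?_
      have : n - 1 = 0 := by
        refine eq_zero_of_mul_γ_eq (m := m - 1) ?_
        push_cast
        linarith
      omega
    have : ⌊((n : ℝ) - 1) * γ⌋ = m - 2 := by
      rw [Int.floor_eq_iff]
      push_cast
      constructor <;> linarith
    rw [hd, this]
    push_cast
    ring

/-! ### Reflection -/

theorem floor_neg_mul_γ {n : ℤ} (hn : n ≠ 0) :
    ⌊-((n : ℝ) * γ)⌋ = -⌊(n : ℝ) * γ⌋ - 1 := by
  have hne : (⌊(n : ℝ) * γ⌋ : ℝ) ≠ n * γ := fun he => hn (eq_zero_of_mul_γ_eq he.symm)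
  have hlt := lt_of_le_of_ne (Int.floor_le ((n : ℝ) * γ)) hne
  have hlt' := Int.lt_floor_add_one ((n : ℝ) * γ)
  rw [Int.floor_eq_iff]
  push_cast
  constructor <;> linarith

/-- Negation swaps the two endpoints. Neither is an integer, so the two corrections `-1` cancel. -/
theorem floor_sub_floor_reflect {n : ℤ} (h0 : n ≠ 0) (h1 : n ≠ 1) :
    ⌊((1 - n : ℤ) : ℝ) * γ⌋ - ⌊(((1 - n : ℤ) : ℝ) - 1) * γ⌋ =
      ⌊(n : ℝ) * γ⌋ - ⌊((n : ℝ) - 1) * γ⌋ := by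
  have e1 := floor_neg_mul_γ h0
  have e2 := floor_neg_mul_γ (sub_ne_zero.2 h1)
  push_cast at e2 ⊢
  rw [show (1 - (n : ℝ)) * γ = -(((n : ℝ) - 1) * γ) by ring,
    show (1 - (n : ℝ) - 1) * γ = -((n : ℝ) * γ) by ring, e1, e2]
  ring

theorem g_eq_floor_sub_floor (i : ℤ) :
    g i = ⌊((i + 2 : ℤ) : ℝ) * γ⌋ - ⌊(((i + 2 : ℤ) : ℝ) - 1) * γ⌋ := by
  unfold g sturmian
  push_cast
  ring_nf

end FibWords

theorem theorem7 :
    (∀ i : ℤ, i ∉ ({-2, -1} : Set ℤ) → FibWords.g i = FibWords.g (-3 - i)) ∧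
    (∀ i : ℤ, i ∉ ({0, 1} : Set ℤ) → FibWords.h i = FibWords.h (1 - i)) ∧
    (∀ i : ℤ, i ∉ ({-1, 0} : Set ℤ) → FibWords.g (i - 1) = (FibWords.h (i + 1) : ℤ)) := by
  simp only [Set.mem_insert_iff, Set.mem_singleton_iff, not_or]
  refine ⟨fun i hi => ?_, fun i hi => ?_, fun i hi => ?_⟩
  -- With `n = i + 2`, the index `-3 - i` corresponds to `1 - n`.
  · rw [FibWords.g_eq_floor_sub_floor, FibWords.g_eq_floor_sub_floor,
      ← FibWords.floor_sub_floor_reflect (n := i + 2) (by omega) (by omega),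
      show 1 - (i + 2) = -3 - i + 2 by ring]
  · zify
    rw [FibWords.h_eq_floor_sub_floor hi.1 hi.2,
      FibWords.h_eq_floor_sub_floor (n := 1 - i) (by omega) (by omega),
      FibWords.floor_sub_floor_reflect hi.1 hi.2]
  · rw [FibWords.g_eq_floor_sub_floor,
      FibWords.h_eq_floor_sub_floor (n := i + 1) (by omega) (by omega),
      show i - 1 + 2 = i + 1 by ring]
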